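/- Let $(E,\mathcal E)$ be a countably generated measurable space and let $V:E\to(0,+\infty)$ be measurable. Let $L^\infty(V)$ be the space of measurable functions $f:E\to\mathbb C$ for which there is a constant $C>0$ with $|f(x)|\le C\,V(x)$ for all $x\in E$, endowed with the norm $\|f\|_V=\sup_{x\in E}|f(x)|/V(x)$ and with the pointwise order. A *kernel from $E$ to $L^\infty(V)$* is a map $R:E\times\mathcal E\to[0,+\infty]$ such that $R(x,\cdot)$ is a $\sigma$-finite measure for every $x\in E$, $R(\cdot,A)$ is measurable for every $A\in\mathcal E$, and $\sup_{x\in E}\frac{1}{V(x)}\int_E V(y)\,R(x,dy)<\infty$. Such a kernel induces the bounded linear operator $Rf(x)=\int_E f(y)\,R(x,dy)$ on $L^\infty(V)$. For a bounded linear operator $T$ on a Banach space $B$, with $\mathcal K(B)$ the set of compact operators on $B$, the essential spectral radius of $T$ is $$r_{\mathrm{ess}}(T)=\lim_{n\to\infty}\inf\left\{\|T^n-K\|^{1/n} : K\in\mathcal K(B)\right\}.$$ Let $P$ and $Q$ be kernels from $E$ to $L^\infty(V)$ such that $0\le P\le Q$, that is, $0\le Pf\le Qf$ for every $f\in L^\infty(V)$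 with $f\ge 0$. Then $$r_{\mathrm{ess}}(P)\le r_{\mathrm{ess}}(Q).$$ -/

import Mathlib

open MeasureTheory ProbabilityTheory Filter Topology
open scoped ENNReal NNReal ComplexOrder

/-! ### The essential spectral radius of a bounded operator -/

section EssentialSpectralRadius

variable {𝕜 B : Type*} [NontriviallyNormedField 𝕜] [NormedAddCommGroup B] [NormedSpace 𝕜 B]

/-- The infimum of `‖T ^ n - K‖ ^ (1 / n)` over all compact operators `K`. -/
noncomputable def essSpectralRadiusSeq (T : B →L[𝕜] B) (n : ℕ) : ℝ :=
  ⨅ K : {K : B →L[𝕜] B // IsCompactOperator K}, ‖T ^ n - K.1‖ ^ (1 / (n : ℝ))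

/-- The essential spectral radius `lim_n inf {‖T ^ n - K‖ ^ (1 / n) : K compact}`. The limit
always exists, see `tendsto_essSpectralRadiusSeq`. -/
noncomputable def essSpectralRadius (T : B →L[𝕜] B) : ℝ :=
  limUnder atTop (essSpectralRadiusSeq T)

theorem essSpectralRadiusSeq_bddBelow (T : B →L[𝕜] B) (n : ℕ) :
    BddBelow (Set.range fun K : {K : B →L[𝕜] B // IsCompactOperator K} =>
      ‖T ^ n - K.1‖ ^ (1 / (n : ℝ))) :=
  ⟨0, by rintro _ ⟨K, rfl⟩; positivity⟩

theorem essSpectralRadiusSeq_nonneg (T : B →L[𝕜] B) (n : ℕ) : 0 ≤ essSpectralRadiusSeq T n :=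
  Real.iInf_nonneg fun _ => by positivity

theorem essSpectralRadiusSeq_pow_lt (T : B →L[𝕜] B) {n : ℕ} (hn : n ≠ 0) {c : ℝ}
    (hc : essSpectralRadiusSeq T n ^ n < c) :
    ∃ K : B →L[𝕜] B, IsCompactOperator K ∧ ‖T ^ n - K‖ < c := by
  have hc0 : 0 ≤ c := (pow_nonneg (essSpectralRadiusSeq_nonneg T n) n).trans hc.le
  have h1 : essSpectralRadiusSeq T n < c ^ (1 / (n : ℝ)) := by
    rw [one_div, ← Real.pow_rpow_inv_natCast (essSpectralRadiusSeq_nonneg T n) hn]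
    exact Real.rpow_lt_rpow (pow_nonneg (essSpectralRadiusSeq_nonneg T n) n) hc (by positivity)
  have : Nonempty {K : B →L[𝕜] B // IsCompactOperator K} := ⟨⟨0, isCompactOperator_zero⟩⟩
  obtain ⟨K, hK⟩ := exists_lt_of_ciInf_lt h1
  refine ⟨K.1, K.2, ?_⟩
  exact (Real.rpow_lt_rpow_iff (norm_nonneg _) hc0 (by positivity)).1 hK

theorem essSpectralRadiusSeq_pow_le (T : B →L[𝕜] B) {n : ℕ} (hn : n ≠ 0) {K : B →L[𝕜] B}
    (hK : IsCompactOperator K) : essSpectralRadiusSeq T n ^ n ≤ ‖T ^ n - K‖ := by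
  have h := ciInf_le (essSpectralRadiusSeq_bddBelow T n) ⟨K, hK⟩
  have h2 := pow_le_pow_left₀ (essSpectralRadiusSeq_nonneg T n) h n
  rwa [one_div, Real.rpow_inv_natCast_pow (norm_nonneg _) hn] at h2

theorem essSpectralRadiusSeq_submul (T : B →L[𝕜] B) {m n : ℕ} (hm : m ≠ 0) (hn : n ≠ 0) :
    essSpectralRadiusSeq T (m + n) ^ (m + n) ≤
      essSpectralRadiusSeq T m ^ m * essSpectralRadiusSeq T n ^ n := by
  have key : ∀ ε > 0, essSpectralRadiusSeq T (m + n) ^ (m + n) ≤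
      (essSpectralRadiusSeq T m ^ m + ε) * (essSpectralRadiusSeq T n ^ n + ε) := by
    intro ε hε
    obtain ⟨K, hK, hK'⟩ := essSpectralRadiusSeq_pow_lt T hm (lt_add_of_pos_right _ hε)
    obtain ⟨L, hL, hL'⟩ := essSpectralRadiusSeq_pow_lt T hn (lt_add_of_pos_right _ hε)
    have hc : IsCompactOperator (T ^ m * L + K * (T ^ n - L) : B →L[𝕜] B) :=
      (hL.clm_comp (T ^ m)).add (hK.comp_clm (T ^ n - L))
    refine (essSpectralRadiusSeq_pow_le T (by omega) hc).trans ?_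
    have : T ^ (m + n) - (T ^ m * L + K * (T ^ n - L)) = (T ^ m - K) * (T ^ n - L) := by
      rw [pow_add]; noncomm_ring
    rw [this]
    exact (norm_mul_le _ _).trans
      (mul_le_mul hK'.le hL'.le (norm_nonneg _) ((norm_nonneg _).trans hK'.le))
  have ht : Tendsto (fun ε : ℝ => (essSpectralRadiusSeq T m ^ m + ε) *
      (essSpectralRadiusSeq T n ^ n + ε)) (𝓝[>] 0)
      (𝓝 (essSpectralRadiusSeq T m ^ m * essSpectralRadiusSeq T n ^ n)) := by
    have : ContinuousAt (fun ε : ℝ => (essSpectralRadiusSeq T m ^ m + ε) *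
      (essSpectralRadiusSeq T n ^ n + ε)) 0 := by fun_prop
    have h := this.tendsto
    simp only [add_zero] at h
    exact h.mono_left nhdsWithin_le_nhds
  exact ge_of_tendsto ht (eventually_nhdsWithin_of_forall fun ε hε => key ε hε)

/-- The limit that defines the essential spectral radius exists. -/
theorem tendsto_essSpectralRadiusSeq (T : B →L[𝕜] B) :
    Tendsto (essSpectralRadiusSeq T) atTop (𝓝 (essSpectralRadius T)) := by
  set a := essSpectralRadiusSeq T with ha
  have a0 : ∀ n, 0 ≤ a n := essSpectralRadiusSeq_nonneg T
  refine tendsto_nhds_limUnder ?_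
  by_cases hz : ∃ m, m ≠ 0 ∧ a m = 0
  · obtain ⟨m, hm, hm0⟩ := hz
    refine ⟨0, tendsto_const_nhds.congr' ?_⟩
    filter_upwards [eventually_gt_atTop m] with n hn
    have h := essSpectralRadiusSeq_submul T hm (show n - m ≠ 0 by omega)
    rw [← ha, hm0, zero_pow hm, zero_mul, show m + (n - m) = n by omega] at h
    exact (eq_zero_of_pow_eq_zero (le_antisymm h (pow_nonneg (a0 n) n))).symm
  · push Not at hz
    have apos : ∀ n, n ≠ 0 → 0 < a n := fun n hn => (a0 n).lt_of_ne (hz n hn).symm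
    have hsub : Subadditive fun n : ℕ => (n : ℝ) * Real.log (a n) := by
      intro m n
      rcases eq_or_ne m 0 with rfl | hm
      · simp
      rcases eq_or_ne n 0 with rfl | hn
      · simp
      have h := Real.log_le_log (pow_pos (apos _ (by omega)) _)
        (essSpectralRadiusSeq_submul T hm hn)
      rw [← ha, Real.log_mul (pow_pos (apos m hm) m).ne' (pow_pos (apos n hn) n).ne',
        Real.log_pow, Real.log_pow, Real.log_pow] at h
      exact h
    have hbdd : BddBelow (a '' Set.Ici 1) := ⟨0, by rintro _ ⟨n, -, rfl⟩; exact a0 n⟩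
    refine ⟨sInf (a '' Set.Ici 1), tendsto_order.2 ⟨fun l hl => ?_, fun L hL => ?_⟩⟩
    · filter_upwards [eventually_ge_atTop 1] with n hn
      exact hl.trans_le (csInf_le hbdd ⟨n, hn, rfl⟩)
    · obtain ⟨_, ⟨m, hm, rfl⟩, hmL⟩ :=
        exists_lt_of_csInf_lt ((Set.nonempty_Ici (a := 1)).image a) hL
      have hm' : m ≠ 0 := Nat.one_le_iff_ne_zero.1 hm
      have hdiv : ∀ n : ℕ, n ≠ 0 → (n : ℝ) * Real.log (a n) / n = Real.log (a n) := by
        intro n hn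
        field_simp
      have h := hsub.eventually_div_lt_of_div_lt (L := Real.log L) hm' (by
        rw [hdiv m hm']
        exact Real.log_lt_log (apos m hm') hmL)
      filter_upwards [h, eventually_ge_atTop 1] with n hn hn1
      have hn0 : n ≠ 0 := by omega
      rw [hdiv n hn0] at hn
      exact (Real.log_lt_log_iff (apos n hn0) ((a0 m).trans_lt hmL)).1 hn

end EssentialSpectralRadius

/-! ### The weighted supremum space `L^∞(V)` -/

section WeightedSpace

variable {E : Type*} [MeasurableSpace E]

/-- The space `L^∞(V)` of all measurable `f : E → ℂ` with `|f| ≤ C V` for some constant `C`. -/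
structure WeightedLInf (V : E → Set.Ioi (0 : ℝ)) where
  toFun : E → ℂ
  measurable_toFun : Measurable toFun
  bounded_toFun : ∃ C : ℝ, ∀ x, ‖toFun x‖ ≤ C * V x

namespace WeightedLInf

variable {V : E → Set.Ioi (0 : ℝ)}

instance : FunLike (WeightedLInf V) E ℂ where
  coe := toFun
  coe_injective := by
    rintro ⟨f, _, _⟩ ⟨g, _, _⟩ h
    congr

instance : Zero (WeightedLInf V) := ⟨⟨0, measurable_const, 0, by simp⟩⟩

instance : Add (WeightedLInf V) := ⟨fun f g => ⟨f + g, f.2.add g.2, by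
  obtain ⟨C, hC⟩ := f.3
  obtain ⟨D, hD⟩ := g.3
  refine ⟨C + D, fun x => (norm_add_le _ _).trans ?_⟩
  rw [add_mul]
  exact add_le_add (hC x) (hD x)⟩⟩

instance : SMul ℂ (WeightedLInf V) := ⟨fun c f => ⟨c • (f : E → ℂ), f.2.const_smul c, by
  obtain ⟨C, hC⟩ := f.3
  refine ⟨‖c‖ * C, fun x => ?_⟩
  rw [Pi.smul_apply, norm_smul, mul_assoc]
  exact mul_le_mul_of_nonneg_left (hC x) (norm_nonneg c)⟩⟩

instance : Neg (WeightedLInf V) := ⟨fun f => ⟨-(f : E → ℂ), f.2.neg, by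
  obtain ⟨C, hC⟩ := f.3
  exact ⟨C, fun x => (norm_neg _).trans_le (hC x)⟩⟩⟩

instance : AddCommGroup (WeightedLInf V) where
  add_assoc f g h := DFunLike.coe_injective (add_assoc (f : E → ℂ) g h)
  zero_add f := DFunLike.coe_injective (zero_add (f : E → ℂ))
  add_zero f := DFunLike.coe_injective (add_zero (f : E → ℂ))
  neg_add_cancel f := DFunLike.coe_injective (neg_add_cancel (f : E → ℂ))
  add_comm f g := DFunLike.coe_injective (add_comm (f : E → ℂ) g)
  nsmul := nsmulRec
  zsmul := zsmulRec

instance : Module ℂ (WeightedLInf V) where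
  one_smul f := DFunLike.coe_injective (one_smul ℂ (f : E → ℂ))
  mul_smul c d f := DFunLike.coe_injective (mul_smul c d (f : E → ℂ))
  smul_zero c := DFunLike.coe_injective (smul_zero (A := E → ℂ) c)
  smul_add c f g := DFunLike.coe_injective (smul_add c (f : E → ℂ) g)
  add_smul c d f := DFunLike.coe_injective (add_smul c d (f : E → ℂ))
  zero_smul f := DFunLike.coe_injective (zero_smul ℂ (f : E → ℂ))

theorem measurable (f : WeightedLInf V) : Measurable f := f.2

theorem ext {f g : WeightedLInf V} (h : ∀ x, f x = g x) : f = g := DFunLike.ext f g h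

theorem zero_apply (x : E) : (0 : WeightedLInf V) x = 0 := rfl

theorem add_apply (f g : WeightedLInf V) (x : E) : (f + g) x = f x + g x := rfl

theorem smul_apply (c : ℂ) (f : WeightedLInf V) (x : E) : (c • f) x = c * f x := rfl

/-- The pointwise order; on `ℂ`, `z ≤ w` means that `w - z` is real and nonnegative. -/
instance : PartialOrder (WeightedLInf V) where
  le f g := ∀ x, f x ≤ g x
  le_refl _ _ := le_rfl
  le_trans _ _ _ hfg hgh x := (hfg x).trans (hgh x)
  le_antisymm _ _ hfg hgf := ext fun x => le_antisymm (hfg x) (hgf x)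

/-- The weighted supremum norm `sup_x |f x| / V x`. -/
noncomputable instance : Norm (WeightedLInf V) := ⟨fun f => ⨆ x, ‖f x‖ / V x⟩

theorem norm_def (f : WeightedLInf V) : ‖f‖ = ⨆ x, ‖f x‖ / V x := rfl

theorem bddAbove (f : WeightedLInf V) : BddAbove (Set.range fun x => ‖f x‖ / (V x : ℝ)) := by
  obtain ⟨C, hC⟩ := f.3
  refine ⟨C, ?_⟩
  rintro _ ⟨x, rfl⟩
  exact (div_le_iff₀ (V x).2).2 (hC x)

theorem norm_apply_le (f : WeightedLInf V) (x : E) : ‖f x‖ ≤ ‖f‖ * V x :=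
  (div_le_iff₀ (V x).2).1 (le_ciSup f.bddAbove x)

theorem norm_nonneg' (f : WeightedLInf V) : 0 ≤ ‖f‖ :=
  Real.iSup_nonneg fun x => div_nonneg (norm_nonneg _) (V x).2.le

theorem norm_le_of_forall (f : WeightedLInf V) {C : ℝ} (hC : 0 ≤ C) (h : ∀ x, ‖f x‖ ≤ C * V x) :
    ‖f‖ ≤ C :=
  Real.iSup_le (fun x => (div_le_iff₀ (V x).2).2 (h x)) hC

theorem normedSpaceCore : NormedSpace.Core ℂ (WeightedLInf V) where
  norm_nonneg := norm_nonneg'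
  norm_smul c f := by
    simp only [norm_def, smul_apply, norm_mul, mul_div_assoc]
    rw [Real.mul_iSup_of_nonneg (norm_nonneg c)]
  norm_triangle f g := by
    refine norm_le_of_forall _ (add_nonneg f.norm_nonneg' g.norm_nonneg') fun x => ?_
    rw [add_apply, add_mul]
    exact (norm_add_le _ _).trans (add_le_add (f.norm_apply_le x) (g.norm_apply_le x))
  norm_eq_zero_iff f := by
    constructor
    · intro h
      refine ext fun x => ?_
      have := f.norm_apply_le x
      rw [h, zero_mul] at this
      exact norm_le_zero_iff.1 this
    · rintro rfl
      exact le_antisymm (norm_le_of_forall _ le_rfl fun x => by simp [zero_apply])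
        (norm_nonneg' _)

noncomputable instance : NormedAddCommGroup (WeightedLInf V) :=
  NormedAddCommGroup.ofCore normedSpaceCore

noncomputable instance : NormedSpace ℂ (WeightedLInf V) := NormedSpace.ofCore normedSpaceCore

end WeightedLInf

/-! ### Kernels acting on `L^∞(V)` -/

/-- `R` is a kernel from `E` to `L^∞(V)`: all `R x` are σ-finite and `x ↦ ∫ V dR(x, ·)` is bounded
by a finite multiple of `V`. -/
structure IsKernelTo (V : E → Set.Ioi (0 : ℝ)) (R : Kernel E E) : Prop where
  sigmaFinite : ∀ x, SigmaFinite (R x)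
  bound : ∃ C : ℝ≥0, ∀ x, ∫⁻ y, ENNReal.ofReal (V y) ∂(R x) ≤ C * ENNReal.ofReal (V x)

namespace IsKernelTo

variable {V : E → Set.Ioi (0 : ℝ)} {R : Kernel E E}

theorem lintegral_le (f : WeightedLInf V) (x : E) : ∫⁻ y, ‖f y‖ₑ ∂(R x) ≤
    ENNReal.ofReal ‖f‖ * ∫⁻ y, ENNReal.ofReal (V y) ∂(R x) := by
  rw [← lintegral_const_mul' _ _ ENNReal.ofReal_ne_top]
  refine lintegral_mono fun y => ?_
  rw [← ofReal_norm, ← ENNReal.ofReal_mul (norm_nonneg f)]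
  exact ENNReal.ofReal_le_ofReal (f.norm_apply_le y)

theorem integrable (hR : IsKernelTo V R) (f : WeightedLInf V) (x : E) :
    Integrable (fun y => f y) (R x) := by
  obtain ⟨C, hC⟩ := hR.bound
  refine ⟨f.measurable.aestronglyMeasurable, (lintegral_le f x).trans_lt ?_⟩
  exact ENNReal.mul_lt_top ENNReal.ofReal_lt_top
    ((hC x).trans_lt (ENNReal.mul_lt_top ENNReal.coe_lt_top ENNReal.ofReal_lt_top))

theorem norm_integral_le {C : ℝ≥0}
    (hC : ∀ x, ∫⁻ y, ENNReal.ofReal (V y) ∂(R x) ≤ C * ENNReal.ofReal (V x))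
    (f : WeightedLInf V) (x : E) : ‖∫ y, f y ∂(R x)‖ ≤ C * ‖f‖ * V x := by
  have hV : (0 : ℝ) ≤ V x := (V x).2.le
  have h0 : 0 ≤ (C : ℝ) * ‖f‖ := mul_nonneg C.2 (norm_nonneg f)
  rw [← ENNReal.ofReal_le_ofReal_iff (mul_nonneg h0 hV), ofReal_norm]
  refine (enorm_integral_le_lintegral_enorm _).trans ((lintegral_le f x).trans ?_)
  refine (mul_le_mul_right (hC x) _).trans (le_of_eq ?_)
  rw [ENNReal.ofReal_mul h0, ENNReal.ofReal_mul C.coe_nonneg, ENNReal.ofReal_coe_nnreal]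
  ring

/-- The bounded linear operator `f ↦ (x ↦ ∫ f dR(x, ·))` on `L^∞(V)`. -/
noncomputable def op (hR : IsKernelTo V R) : WeightedLInf V →L[ℂ] WeightedLInf V :=
  LinearMap.mkContinuousOfExistsBound
    { toFun := fun f => ⟨fun x => ∫ y, f y ∂(R x),
        (f.measurable.stronglyMeasurable.integral_kernel (κ := R)).measurable,
        hR.bound.choose * ‖f‖, norm_integral_le hR.bound.choose_spec f⟩
      map_add' := fun f g => WeightedLInf.ext fun x =>
        integral_add (hR.integrable f x) (hR.integrable g x)
      map_smul' := fun c _ => WeightedLInf.ext fun _ => integral_const_mul c _ }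
    ⟨hR.bound.choose, fun f => WeightedLInf.norm_le_of_forall _
      (mul_nonneg hR.bound.choose.2 (norm_nonneg f)) (norm_integral_le hR.bound.choose_spec f)⟩

theorem op_apply (hR : IsKernelTo V R) (f : WeightedLInf V) (x : E) :
    hR.op f x = ∫ y, f y ∂(R x) := rfl

end IsKernelTo

end WeightedSpace

/-! ### Operators on `L^∞(V)` induced by finite kernels -/

/-! Conjugation by `V` turns `P` and `Q` into finite kernels `κ ≤ η` acting on bounded functions, so
that `κ ^ n ≤ η ^ n` for every `n`. Being close to a compact operator is not inherited by smaller
operators, but a measure-theoretic consequence of it is: if `η ^ n` is within `r` of a compact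
operator, then `η ^ n x A ≤ ν A + 3 * r` for one finite measure `ν`, uniformly in `x` and `A`
(`exists_measure_dominating`). The smaller kernel `κ ^ n` satisfies the same bound.

Conversely, such a bound controls the essential spectral radius. The Lebesgue decomposition with
respect to `ν`, with the density truncated, gives `κ ^ n = A + S`, where `A` has a bounded density
and `S` has mass at most `6 * r` (`exists_eq_withDensity_add`). The operator `A` need not be
compact, but every `A * S ^ j * A` is (`isCompactOperator_kernelOp_mul`). In the expansion of `(A +
S) ^ k`, the words with at least two factors `A` are therefore compact. The others have total norm
at most `d ^ k + k * ‖A‖ * d ^ (k - 1)` with `d = 6 * r`, which grows like `d ^ k` up to a linear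
factor (`essSpectralRadius_pow_le_of_compact`).

Hence `r_ess(P) ^ n ≤ 6 * r ^ n` for every `r > r_ess(Q)` and all large `n`, and the constant
disappears after taking `n`-th roots. -/

section KernelOperators

variable {E : Type*} [MeasurableSpace E] {V : E → Set.Ioi (0 : ℝ)}

namespace WeightedLInf

theorem weight_pos {E : Type*} {V : E → Set.Ioi (0 : ℝ)} (x : E) : (0 : ℝ) < V x := (V x).2

theorem norm_div_le (f : WeightedLInf V) (x : E) : ‖f x / ((V x : ℝ) : ℂ)‖ ≤ ‖f‖ := by
  rw [norm_div, Complex.norm_real, Real.norm_of_nonneg (weight_pos x).le]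
  exact (div_le_iff₀ (weight_pos x)).2 (f.norm_apply_le x)

theorem enorm_div_le (f : WeightedLInf V) (x : E) :
    ‖f x / ((V x : ℝ) : ℂ)‖ₑ ≤ ENNReal.ofReal ‖f‖ := by
  rw [← ofReal_norm]
  exact ENNReal.ofReal_le_ofReal (f.norm_div_le x)

theorem measurable_div (hV : Measurable V) (f : WeightedLInf V) :
    Measurable fun x => f x / ((V x : ℝ) : ℂ) :=
  f.measurable.div (Complex.measurable_ofReal.comp (measurable_subtype_coe.comp hV))

theorem integrable_div (hV : Measurable V) (f : WeightedLInf V) (μ : Measure E)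
    [IsFiniteMeasure μ] : Integrable (fun x => f x / ((V x : ℝ) : ℂ)) μ :=
  Integrable.of_bound (f.measurable_div hV).aestronglyMeasurable ‖f‖
    (ae_of_all _ f.norm_div_le)

/-- The function `V * g` for a bounded measurable function `g`. -/
noncomputable def ofBounded (hV : Measurable V) (g : E → ℂ) (hg : Measurable g)
    (hb : ∃ C : ℝ, ∀ x, ‖g x‖ ≤ C) : WeightedLInf V :=
  ⟨fun x => V x * g x,
    (Complex.measurable_ofReal.comp (measurable_subtype_coe.comp hV)).mul hg, by
    obtain ⟨C, hC⟩ := hb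
    refine ⟨C, fun x => ?_⟩
    rw [norm_mul, Complex.norm_real, Real.norm_of_nonneg (weight_pos x).le, mul_comm]
    exact mul_le_mul_of_nonneg_right (hC x) (weight_pos x).le⟩

theorem ofBounded_apply (hV : Measurable V) (g : E → ℂ) (hg : Measurable g)
    (hb : ∃ C : ℝ, ∀ x, ‖g x‖ ≤ C) (x : E) : ofBounded hV g hg hb x = V x * g x := rfl

theorem norm_indicator_one_le {E : Type*} (A : Set E) (x : E) : ‖A.indicator (1 : E → ℂ) x‖ ≤ 1 := by
  by_cases h : x ∈ A <;> simp [h]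

/-- The function `V` on the measurable set `A`, and `0` outside. -/
noncomputable def weightIndicator (hV : Measurable V) {A : Set E} (hA : MeasurableSet A) :
    WeightedLInf V :=
  ofBounded hV (A.indicator 1) (measurable_one.indicator hA) ⟨1, norm_indicator_one_le A⟩

theorem weightIndicator_div (hV : Measurable V) {A : Set E} (hA : MeasurableSet A) (x : E) :
    weightIndicator hV hA x / ((V x : ℝ) : ℂ) = A.indicator 1 x :=
  mul_div_cancel_left₀ _ (Complex.ofReal_ne_zero.2 (weight_pos x).ne')

theorem norm_weightIndicator_le (hV : Measurable V) {A : Set E} (hA : MeasurableSet A) :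
    ‖weightIndicator hV hA‖ ≤ 1 := by
  refine norm_le_of_forall _ zero_le_one fun x => ?_
  rw [weightIndicator, ofBounded_apply, norm_mul, Complex.norm_real,
    Real.norm_of_nonneg (weight_pos x).le, mul_comm]
  exact mul_le_mul_of_nonneg_right (norm_indicator_one_le A x) (weight_pos x).le

theorem weightIndicator_nonneg (hV : Measurable V) {A : Set E} (hA : MeasurableSet A) :
    0 ≤ weightIndicator hV hA := fun x => by
  refine mul_nonneg (Complex.zero_le_real.2 (weight_pos x).le) ?_
  by_cases h : x ∈ A <;> simp [h]

/-- Completeness is what makes the compact operators a closed set, as used in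
`isCompactOperator_kernelOp_mul`. -/
instance : CompleteSpace (WeightedLInf V) := by
  refine Metric.complete_of_cauchySeq_tendsto fun u hu => ?_
  have hdist : ∀ n m x, dist (u n x) (u m x) ≤ dist (u n) (u m) * V x := fun n m x => by
    rw [dist_eq_norm, dist_eq_norm]
    exact (u n - u m).norm_apply_le x
  have hcau : ∀ x, CauchySeq fun n => u n x := fun x => by
    refine Metric.cauchySeq_iff'.2 fun ε hε => ?_
    obtain ⟨N, hN⟩ := Metric.cauchySeq_iff'.1 hu (ε / V x) (div_pos hε (weight_pos x))
    exact ⟨N, fun n hn => (hdist n N x).trans_lt ((lt_div_iff₀ (weight_pos x)).1 (hN n hn))⟩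
  choose g hg using fun x => cauchySeq_tendsto_of_complete (hcau x)
  have hbound : ∀ ε N, (∀ n ≥ N, dist (u n) (u N) < ε) → ∀ x, ‖g x - u N x‖ ≤ ε * V x :=
    fun ε N hN x => by
      refine le_of_tendsto ((hg x).sub_const (u N x)).norm ?_
      filter_upwards [eventually_ge_atTop N] with n hn
      rw [← dist_eq_norm]
      exact (hdist n N x).trans (mul_le_mul_of_nonneg_right (hN n hn).le (weight_pos x).le)
  have hmeas : Measurable g :=
    measurable_of_tendsto_metrizable (fun n => (u n).measurable) (tendsto_pi_nhds.2 hg)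
  have hbdd : ∃ C : ℝ, ∀ x, ‖g x‖ ≤ C * V x := by
    obtain ⟨N, hN⟩ := Metric.cauchySeq_iff'.1 hu 1 one_pos
    refine ⟨1 + ‖u N‖, fun x => ?_⟩
    rw [add_mul]
    calc ‖g x‖ = ‖(g x - u N x) + u N x‖ := by rw [sub_add_cancel]
      _ ≤ _ := (norm_add_le _ _).trans
        (add_le_add (hbound 1 N hN x) ((u N).norm_apply_le x))
  let G : WeightedLInf V := ⟨g, hmeas, hbdd⟩
  refine ⟨G, Metric.tendsto_atTop.2 fun ε hε => ?_⟩
  obtain ⟨N, hN⟩ := Metric.cauchySeq_iff'.1 hu (ε / 4) (by positivity)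
  have hG : dist G (u N) ≤ ε / 4 := by
    rw [dist_eq_norm]
    exact norm_le_of_forall _ (by positivity) (hbound _ N hN)
  refine ⟨N, fun n hn => (dist_triangle_right _ _ (u N)).trans_lt ?_⟩
  linarith [hN n hn]

end WeightedLInf

/-- The operator `f ↦ (x ↦ V x * ∫ f / V dκ(x, ·))` induced by a finite kernel `κ`. -/
noncomputable def kernelOp (hV : Measurable V) (κ : Kernel E E) [IsFiniteKernel κ] :
    WeightedLInf V →L[ℂ] WeightedLInf V :=
  have hb : ∀ (f : WeightedLInf V) (x : E),
      ‖∫ y, f y / ((V y : ℝ) : ℂ) ∂(κ x)‖ ≤ κ.bound.toReal * ‖f‖ := fun f x => by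
    refine (norm_integral_le_of_norm_le_const (ae_of_all _ f.norm_div_le)).trans ?_
    rw [mul_comm]
    exact mul_le_mul_of_nonneg_right
      (ENNReal.toReal_mono κ.bound_ne_top (κ.measure_le_bound x _)) (norm_nonneg f)
  LinearMap.mkContinuousOfExistsBound
    { toFun := fun f => WeightedLInf.ofBounded hV (fun x => ∫ y, f y / ((V y : ℝ) : ℂ) ∂(κ x))
        ((f.measurable_div hV).stronglyMeasurable.integral_kernel (κ := κ)).measurable
        ⟨_, hb f⟩
      map_add' := fun f g => WeightedLInf.ext fun x => by
        simp only [WeightedLInf.ofBounded_apply, WeightedLInf.add_apply, add_div]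
        rw [integral_add (f.integrable_div hV _) (g.integrable_div hV _), mul_add]
      map_smul' := fun c f => WeightedLInf.ext fun x => by
        simp only [WeightedLInf.ofBounded_apply, WeightedLInf.smul_apply, mul_div_assoc,
          RingHom.id_apply]
        rw [integral_const_mul, mul_left_comm] }
    ⟨κ.bound.toReal, fun f => WeightedLInf.norm_le_of_forall _
      (mul_nonneg ENNReal.toReal_nonneg (norm_nonneg f)) fun x => by
        simp only [LinearMap.coe_mk, AddHom.coe_mk, WeightedLInf.ofBounded_apply]
        rw [norm_mul, Complex.norm_real, Real.norm_of_nonneg (WeightedLInf.weight_pos x).le,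
          mul_comm]
        exact mul_le_mul_of_nonneg_right (hb f x) (WeightedLInf.weight_pos x).le⟩

section

variable (hV : Measurable V) (κ η : Kernel E E) [IsFiniteKernel κ] [IsFiniteKernel η]

theorem kernelOp_apply (f : WeightedLInf V) (x : E) :
    kernelOp hV κ f x = V x * ∫ y, f y / ((V y : ℝ) : ℂ) ∂(κ x) := rfl

theorem kernelOp_div (f : WeightedLInf V) (x : E) :
    kernelOp hV κ f x / ((V x : ℝ) : ℂ) = ∫ y, f y / ((V y : ℝ) : ℂ) ∂(κ x) :=
  mul_div_cancel_left₀ _ (Complex.ofReal_ne_zero.2 (WeightedLInf.weight_pos x).ne')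

theorem enorm_kernelOp_div_le (f : WeightedLInf V) (x : E) :
    ‖kernelOp hV κ f x / ((V x : ℝ) : ℂ)‖ₑ ≤ ∫⁻ y, ‖f y / ((V y : ℝ) : ℂ)‖ₑ ∂(κ x) := by
  rw [kernelOp_div]
  exact enorm_integral_le_lintegral_enorm _

theorem WeightedLInf.norm_le_of_enorm_div (f : WeightedLInf V) {C : ℝ} (hC : 0 ≤ C)
    (h : ∀ x, ‖f x / ((V x : ℝ) : ℂ)‖ₑ ≤ ENNReal.ofReal C) : ‖f‖ ≤ C := by
  refine f.norm_le_of_forall hC fun x => ?_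
  have := h x
  rw [← ofReal_norm, ENNReal.ofReal_le_ofReal_iff hC, norm_div, Complex.norm_real,
    Real.norm_of_nonneg (weight_pos x).le] at this
  exact (div_le_iff₀ (weight_pos x)).1 this

theorem norm_kernelOp_le {C : ℝ} (hC : 0 ≤ C) (h : ∀ x, κ x Set.univ ≤ ENNReal.ofReal C) :
    ‖kernelOp hV κ‖ ≤ C := by
  refine ContinuousLinearMap.opNorm_le_bound _ hC fun f => ?_
  refine WeightedLInf.norm_le_of_enorm_div _ (mul_nonneg hC (norm_nonneg f)) fun x => ?_
  refine (enorm_kernelOp_div_le hV κ f x).trans ?_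
  calc ∫⁻ y, ‖f y / ((V y : ℝ) : ℂ)‖ₑ ∂(κ x) ≤ ∫⁻ _, ENNReal.ofReal ‖f‖ ∂(κ x) :=
        lintegral_mono f.enorm_div_le
    _ = ENNReal.ofReal ‖f‖ * κ x Set.univ := by simp
    _ ≤ ENNReal.ofReal ‖f‖ * ENNReal.ofReal C := by gcongr; exact h x
    _ = ENNReal.ofReal (C * ‖f‖) := by rw [← ENNReal.ofReal_mul (norm_nonneg f), mul_comm]

theorem kernelOp_add : kernelOp hV (κ + η) = kernelOp hV κ + kernelOp hV η := by
  refine ContinuousLinearMap.ext fun f => WeightedLInf.ext fun x => ?_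
  simp only [add_apply, WeightedLInf.add_apply, kernelOp_apply]
  rw [integral_add_measure (f.integrable_div hV _) (f.integrable_div hV _), mul_add]

/-- The order is reversed because `η ∘ₖ κ` moves by `κ` before `η`, while operators act on functions
by pulling back. -/
theorem kernelOp_comp : kernelOp hV (η ∘ₖ κ) = kernelOp hV κ * kernelOp hV η := by
  refine ContinuousLinearMap.ext fun f => WeightedLInf.ext fun x => ?_
  rw [mul_apply_eq_comp, kernelOp_apply, kernelOp_apply,
    Kernel.integral_comp (f.integrable_div hV _)]
  simp only [kernelOp_div]

theorem kernelOp_id : kernelOp hV (Kernel.id : Kernel E E) = 1 := by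
  refine ContinuousLinearMap.ext fun f => WeightedLInf.ext fun x => ?_
  rw [kernelOp_apply, Kernel.id_apply, integral_dirac' _ _ (f.measurable_div hV).stronglyMeasurable]
  exact mul_div_cancel₀ _ (Complex.ofReal_ne_zero.2 (WeightedLInf.weight_pos x).ne')

instance isFiniteKernel_pow (n : ℕ) : IsFiniteKernel (κ ^ n) := by
  induction n with
  | zero => exact inferInstanceAs (IsFiniteKernel (Kernel.id : Kernel E E))
  | succ n ih =>
    rw [pow_succ]
    exact inferInstanceAs (IsFiniteKernel ((κ ^ n) ∘ₖ κ))

theorem kernelOp_congr {κ η : Kernel E E} [IsFiniteKernel κ] [IsFiniteKernel η] (h : κ = η) :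
    kernelOp hV κ = kernelOp hV η := by
  subst h; rfl

theorem kernelOp_pow (n : ℕ) : kernelOp hV (κ ^ n) = kernelOp hV κ ^ n := by
  induction n with
  | zero => exact kernelOp_id hV
  | succ n ih =>
    rw [pow_succ' (kernelOp hV κ), ← ih, ← kernelOp_comp]
    exact kernelOp_congr hV (pow_succ κ n)

theorem kernelOp_weightIndicator_div {A : Set E} (hA : MeasurableSet A) (x : E) :
    kernelOp hV κ (WeightedLInf.weightIndicator hV hA) x / ((V x : ℝ) : ℂ) =
      ((κ x A).toReal : ℂ) := by
  rw [kernelOp_div]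
  simp only [WeightedLInf.weightIndicator_div]
  exact (integral_indicator_const (1 : ℂ) hA).trans (by simp [Measure.real])

/-- Testing on `V` times the indicator of `A` recovers `κ x A`; finiteness allows the return from
real to extended values. -/
theorem ProbabilityTheory.Kernel.le_of_kernelOp_le
    (h : ∀ f : WeightedLInf V, 0 ≤ f → kernelOp hV κ f ≤ kernelOp hV η f) : κ ≤ η := by
  refine fun x => Measure.le_iff.2 fun A hA => ?_
  have h1 := h _ (WeightedLInf.weightIndicator_nonneg hV hA) x
  have h2 := mul_le_mul_of_nonneg_right h1
    (Complex.zero_le_real.2 (inv_nonneg.2 (WeightedLInf.weight_pos (V := V) x).le))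
  rw [Complex.ofReal_inv, ← div_eq_mul_inv, ← div_eq_mul_inv, kernelOp_weightIndicator_div,
    kernelOp_weightIndicator_div, Complex.real_le_real] at h2
  exact (ENNReal.toReal_le_toReal (measure_ne_top _ _) (measure_ne_top _ _)).1 h2

theorem ProbabilityTheory.Kernel.pow_le_pow {κ η : Kernel E E} (h : κ ≤ η) (n : ℕ) : κ ^ n ≤ η ^ n := by
  induction n with
  | zero => exact le_rfl
  | succ n ih =>
    refine fun x => Measure.le_iff.2 fun A hA => ?_
    have e : ∀ ξ : Kernel E E, (ξ ^ (n + 1)) x A = ∫⁻ y, (ξ ^ n) y A ∂(ξ x) := fun ξ => by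
      rw [pow_succ]
      exact Kernel.comp_apply' _ _ _ hA
    rw [e, e]
    exact lintegral_mono' (h x) fun y => ih y A

end

end KernelOperators

/-! ### Kernels to `L^∞(V)` as finite kernels -/

namespace IsKernelTo

variable {E : Type*} [MeasurableSpace E] {V : E → Set.Ioi (0 : ℝ)} {R : Kernel E E}

theorem exists_finite_kernel (hV : Measurable V) (hR : IsKernelTo V R) :
    ∃ (κ : Kernel E E) (_ : IsFiniteKernel κ), hR.op = kernelOp hV κ := by
  have mV : Measurable fun y => (V y : ℝ) := measurable_subtype_coe.comp hV
  have md : ∀ x, Measurable fun y => ENNReal.ofReal (V y / V x) := fun x =>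
    (mV.div_const _).ennreal_ofReal
  have hd : ∀ x y, ENNReal.ofReal (V y / V x) =
      ENNReal.ofReal (V y) * (ENNReal.ofReal (V x))⁻¹ := fun x y => by
    rw [ENNReal.ofReal_div_of_pos (V x).2, div_eq_mul_inv]
  -- The density `V y / V x` cancels the weights in `kernelOp`, and the bound in `IsKernelTo`
  -- becomes a uniform bound on the total mass.
  let κ : Kernel E E :=
    { toFun := fun x => (R x).withDensity fun y => ENNReal.ofReal (V y / V x)
      measurable' := by
        refine Measure.measurable_of_measurable_coe _ fun s hs => ?_
        simp only [withDensity_apply _ hs, hd]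
        have : ∀ x, ∫⁻ y in s, ENNReal.ofReal (V y) * (ENNReal.ofReal (V x))⁻¹ ∂(R x) =
            (∫⁻ y in s, ENNReal.ofReal (V y) ∂(R x)) * (ENNReal.ofReal (V x))⁻¹ := fun x =>
          lintegral_mul_const _ mV.ennreal_ofReal
        simp only [this]
        have hm : Measurable fun x => ∫⁻ y in s, ENNReal.ofReal (V y) ∂(R x) := by
          simp only [← lintegral_indicator hs]
          exact (Measure.measurable_lintegral (mV.ennreal_ofReal.indicator hs)).comp R.measurable
        exact hm.mul mV.ennreal_ofReal.inv }
  have hκ : ∀ x, κ x = (R x).withDensity fun y => ENNReal.ofReal (V y / V x) := fun x => rfl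
  obtain ⟨C, hC⟩ := hR.bound
  have hfin : IsFiniteKernel κ := by
    refine ⟨⟨C, ENNReal.coe_lt_top, fun x => ?_⟩⟩
    have h0 : ENNReal.ofReal (V x) ≠ 0 := (ENNReal.ofReal_pos.2 (V x).2).ne'
    rw [hκ, withDensity_apply _ MeasurableSet.univ, setLIntegral_univ]
    simp only [hd]
    rw [lintegral_mul_const _ mV.ennreal_ofReal, ← div_eq_mul_inv]
    exact (ENNReal.div_le_iff h0 ENNReal.ofReal_ne_top).2 (hC x)
  refine ⟨κ, hfin, ContinuousLinearMap.ext fun f => WeightedLInf.ext fun x => ?_⟩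
  rw [kernelOp_apply, op_apply, hκ, integral_withDensity_eq_integral_toReal_smul (md x)
    (ae_of_all _ fun _ => ENNReal.ofReal_lt_top), ← integral_const_mul]
  refine integral_congr_ae (ae_of_all _ fun y => ?_)
  have h1 : ((V x : ℝ) : ℂ) ≠ 0 := Complex.ofReal_ne_zero.2 (V x).2.ne'
  have h2 : ((V y : ℝ) : ℂ) ≠ 0 := Complex.ofReal_ne_zero.2 (V y).2.ne'
  simp only
  rw [ENNReal.toReal_ofReal (div_nonneg (V y).2.le (V x).2.le), Complex.real_smul,
    Complex.ofReal_div]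
  field_simp

end IsKernelTo

/-! ### Upper bounds for the essential spectral radius -/

section EssentialSpectralRadiusBound

variable {𝕜 B : Type*} [NontriviallyNormedField 𝕜] [NormedAddCommGroup B] [NormedSpace 𝕜 B]

/-- Here `L` is the sum of the words `S ^ i * A * S ^ (k - 1 - i)` with exactly one factor `A`, and
`K` collects the words with at least two. The factor `d` on the left of the norm bound avoids the
exponent `k - 1`; the last clause, for all `j`, is what keeps the induction going. -/
theorem exists_add_pow_eq_add_compact (A S : B →L[𝕜] B)
    (hA : ∀ j : ℕ, IsCompactOperator (A * S ^ j * A : B →L[𝕜] B)) {d : ℝ} (hS : ‖S‖ ≤ d) (k : ℕ) :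
    ∃ L K : B →L[𝕜] B, IsCompactOperator K ∧ (A + S) ^ k = S ^ k + L + K ∧
      ‖L‖ * d ≤ k * ‖A‖ * d ^ k ∧ ∀ j : ℕ, IsCompactOperator (L * S ^ j * A : B →L[𝕜] B) := by
  have hd : 0 ≤ d := (norm_nonneg S).trans hS
  induction k with
  | zero => exact ⟨0, 0, isCompactOperator_zero, by simp, by simp, fun j => by
      simpa using isCompactOperator_zero⟩
  | succ k ih =>
    obtain ⟨L, K, hK, hk, hL, hc⟩ := ih
    refine ⟨S ^ k * A + L * S, L * A + K * (A + S), ?_, ?_, ?_, fun j => ?_⟩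
    · have h := hc 0
      rw [pow_zero, mul_one] at h
      exact h.add (hK.comp_clm (A + S))
    · rw [pow_succ, hk, pow_succ]
      noncomm_ring
    · have h1 : ‖S ^ k * A‖ ≤ d ^ k * ‖A‖ := by
        -- The case `k = 0` is separate because `‖1‖ = 1` fails when `B` is trivial.
        rcases k.eq_zero_or_pos with rfl | hk0
        · simp
        · exact (norm_mul_le _ _).trans (mul_le_mul_of_nonneg_right
            ((norm_pow_le' S hk0).trans (pow_le_pow_left₀ (norm_nonneg S) hS k)) (norm_nonneg A))
      have h2 : ‖L * S‖ ≤ ‖L‖ * d :=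
        (norm_mul_le _ _).trans (mul_le_mul_of_nonneg_left hS (norm_nonneg L))
      calc ‖S ^ k * A + L * S‖ * d ≤ (d ^ k * ‖A‖ + k * ‖A‖ * d ^ k) * d :=
            mul_le_mul_of_nonneg_right ((norm_add_le _ _).trans (add_le_add h1 (h2.trans hL))) hd
        _ = _ := by push_cast; ring
    · have : (S ^ k * A + L * S) * S ^ j * A = S ^ k * (A * S ^ j * A) + L * S ^ (j + 1) * A := by
        rw [pow_succ' S j]; noncomm_ring
      rw [this]
      exact ((hA j).clm_comp (S ^ k)).add (hc (j + 1))

theorem essSpectralRadius_nonneg (T : B →L[𝕜] B) : 0 ≤ essSpectralRadius T :=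
  ge_of_tendsto' (tendsto_essSpectralRadiusSeq T) (essSpectralRadiusSeq_nonneg T)

/-- Up to compact operators, `T ^ (n * k)` has norm at most `d ^ k + k * ‖A‖ * d ^ (k - 1)`, which
is eventually below `e ^ k` for each `e > d`. The limit is then taken along the multiples of `n`. -/
theorem essSpectralRadius_pow_le_of_compact (T : B →L[𝕜] B) {n : ℕ} (hn : n ≠ 0)
    (A S : B →L[𝕜] B) (hT : T ^ n = A + S)
    (hA : ∀ j : ℕ, IsCompactOperator (A * S ^ j * A : B →L[𝕜] B)) {d : ℝ} (hd : 0 < d)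
    (hS : ‖S‖ ≤ d) : essSpectralRadius T ^ n ≤ d := by
  refine le_of_forall_gt_imp_ge_of_dense fun e he => ?_
  have he0 : 0 < e := hd.trans he
  have hq : d / e < 1 := (div_lt_one he0).2 he
  have hq0 : 0 ≤ d / e := div_nonneg hd.le he0.le
  have hlim : Tendsto (fun k : ℕ => (d / e) ^ k + ‖A‖ / d * (k * (d / e) ^ k)) atTop (𝓝 0) := by
    simpa using (tendsto_pow_atTop_nhds_zero_of_lt_one hq0 hq).add
      ((tendsto_self_mul_const_pow_of_lt_one hq0 hq).const_mul (‖A‖ / d))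
  have hev : ∀ᶠ k : ℕ in atTop, essSpectralRadiusSeq T (n * k) ^ n ≤ e := by
    filter_upwards [hlim.eventually_lt_const zero_lt_one, eventually_ne_atTop 0] with k hk hk0
    obtain ⟨L, K, hK, hTk, hL, -⟩ := exists_add_pow_eq_add_compact A S hA hS k
    have h1 := essSpectralRadiusSeq_pow_le T (mul_ne_zero hn hk0) hK
    rw [pow_mul T, hT, hTk, add_sub_cancel_right, pow_mul] at h1
    have h2 : ‖S ^ k + L‖ ≤ e ^ k := by
      have h3 : ‖L‖ ≤ k * ‖A‖ * d ^ k / d := (le_div_iff₀ hd).2 hL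
      have h4 : ‖S ^ k‖ ≤ d ^ k :=
        (norm_pow_le' S (Nat.pos_of_ne_zero hk0)).trans (pow_le_pow_left₀ (norm_nonneg S) hS k)
      calc ‖S ^ k + L‖ ≤ d ^ k + k * ‖A‖ * d ^ k / d := (norm_add_le _ _).trans (add_le_add h4 h3)
        _ = ((d / e) ^ k + ‖A‖ / d * (k * (d / e) ^ k)) * e ^ k := by
            rw [div_pow]; field_simp
        _ ≤ e ^ k := mul_le_of_le_one_left (pow_nonneg he0.le k) hk.le
    exact (pow_le_pow_iff_left₀ (pow_nonneg (essSpectralRadiusSeq_nonneg T _) n) he0.le hk0).1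
      (h1.trans h2)
  have hsub : Tendsto (fun k : ℕ => n * k) atTop atTop :=
    tendsto_id.const_mul_atTop' (Nat.pos_of_ne_zero hn)
  exact le_of_tendsto (((tendsto_essSpectralRadiusSeq T).comp hsub).pow n) hev

theorem essSpectralRadius_le_of_pow_le (T U : B →L[𝕜] B) {C : ℝ} (hC : 0 < C)
    (h : ∀ n : ℕ, n ≠ 0 → ∀ r : ℝ, 0 < r → ∀ K : B →L[𝕜] B, IsCompactOperator K →
      ‖U ^ n - K‖ < r → essSpectralRadius T ^ n ≤ C * r) :
    essSpectralRadius T ≤ essSpectralRadius U := by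
  refine le_of_forall_gt_imp_ge_of_dense fun r hr => ?_
  have hr0 : 0 < r := (essSpectralRadius_nonneg U).trans_lt hr
  have hev : ∀ᶠ n : ℕ in atTop, essSpectralRadius T ≤ C ^ (1 / (n : ℝ)) * r := by
    filter_upwards [(tendsto_essSpectralRadiusSeq U).eventually_lt_const hr,
      eventually_ne_atTop 0] with n hn hn0
    obtain ⟨K, hK, hK'⟩ := essSpectralRadiusSeq_pow_lt U hn0
      (pow_lt_pow_left₀ hn (essSpectralRadiusSeq_nonneg U n) hn0)
    have h1 := h n hn0 (r ^ n) (pow_pos hr0 n) K hK hK'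
    refine (pow_le_pow_iff_left₀ (essSpectralRadius_nonneg T) (by positivity) hn0).1 ?_
    rwa [mul_pow, one_div, Real.rpow_inv_natCast_pow hC.le hn0]
  have hlim : Tendsto (fun n : ℕ => C ^ (1 / (n : ℝ)) * r) atTop (𝓝 r) := by
    have := (tendsto_const_nhds (x := C)).rpow tendsto_one_div_atTop_nhds_zero_nat (Or.inl hC.ne')
    simpa using this.mul_const r
  exact ge_of_tendsto hlim hev

end EssentialSpectralRadiusBound

/-! ### Density of finite sums of products in `L¹` of a product measure -/

section Density

variable {X Y : Type*} [MeasurableSpace X] [MeasurableSpace Y]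

/-- The span of the products `a(x) b(y)` of bounded measurable functions. -/
def productSpan (X Y : Type*) [MeasurableSpace X] [MeasurableSpace Y] :
    Submodule ℂ (X × Y → ℂ) :=
  Submodule.span ℂ {h | ∃ (a : X → ℂ) (b : Y → ℂ), Measurable a ∧ Measurable b ∧
    (∃ C, ∀ x, ‖a x‖ ≤ C) ∧ (∃ C, ∀ y, ‖b y‖ ≤ C) ∧ h = fun p => a p.1 * b p.2}

theorem measurable_bounded_of_mem_productSpan {h : X × Y → ℂ} (hh : h ∈ productSpan X Y) :
    Measurable h ∧ ∃ C, ∀ p, ‖h p‖ ≤ C := by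
  induction hh using Submodule.span_induction with
  | mem h hh =>
    obtain ⟨a, b, ha, hb, ⟨C, hC⟩, ⟨D, hD⟩, rfl⟩ := hh
    refine ⟨(ha.comp measurable_fst).mul (hb.comp measurable_snd), C * D, fun p => ?_⟩
    rw [norm_mul]
    exact mul_le_mul (hC _) (hD _) (norm_nonneg _) ((norm_nonneg _).trans (hC p.1))
  | zero => exact ⟨measurable_zero, 0, fun p => by simp⟩
  | add f g _ _ hf hg =>
    obtain ⟨mf, C, hC⟩ := hf
    obtain ⟨mg, D, hD⟩ := hg
    exact ⟨mf.add mg, C + D, fun p => (norm_add_le _ _).trans (add_le_add (hC p) (hD p))⟩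
  | smul c f _ hf =>
    obtain ⟨mf, C, hC⟩ := hf
    refine ⟨mf.const_smul c, ‖c‖ * C, fun p => ?_⟩
    rw [Pi.smul_apply, norm_smul]
    exact mul_le_mul_of_nonneg_left (hC p) (norm_nonneg c)

theorem indicator_prod_mem_productSpan {s : Set X} {t : Set Y} (hs : MeasurableSet s)
    (ht : MeasurableSet t) : (s ×ˢ t).indicator (1 : X × Y → ℂ) ∈ productSpan X Y := by
  refine Submodule.subset_span ⟨s.indicator 1, t.indicator 1, measurable_one.indicator hs,
    measurable_one.indicator ht, ⟨1, fun x => ?_⟩, ⟨1, fun y => ?_⟩, ?_⟩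
  · by_cases h : x ∈ s <;> simp [h]
  · by_cases h : y ∈ t <;> simp [h]
  · ext p
    by_cases h1 : p.1 ∈ s <;> by_cases h2 : p.2 ∈ t <;> simp [Set.indicator, h1, h2]

/-- A π-λ argument starting from rectangles. The quantifier over `ε` stays inside the claim because
a disjoint union needs its pieces approximated at different precisions. -/
theorem exists_productSpan_indicator_near (m : Measure (X × Y)) [IsFiniteMeasure m]
    {S : Set (X × Y)} (hS : MeasurableSet S) : ∀ ε : ℝ≥0∞, ε ≠ 0 → ∃ g ∈ productSpan X Y,
      eLpNorm (g - S.indicator 1) 1 m ≤ ε := by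
  have hone : (1 : X × Y → ℂ) ∈ productSpan X Y := by
    simpa using indicator_prod_mem_productSpan (X := X) (Y := Y) MeasurableSet.univ
      MeasurableSet.univ
  have meas : ∀ {g}, g ∈ productSpan X Y → ∀ {S}, MeasurableSet S →
      AEStronglyMeasurable (g - S.indicator 1) m := fun hg S hS =>
    ((measurable_bounded_of_mem_productSpan hg).1.sub
      (measurable_one.indicator hS)).aestronglyMeasurable
  induction S, hS using MeasurableSpace.induction_on_inter generateFrom_prod.symm
    isPiSystem_prod with
  | empty => exact fun ε _ => ⟨0, zero_mem _, by simp⟩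
  | basic S hS =>
    obtain ⟨s, hs, t, ht, rfl⟩ := hS
    exact fun ε _ => ⟨_, indicator_prod_mem_productSpan hs ht, by simp⟩
  | compl S hS ih =>
    intro ε hε
    obtain ⟨g, hg, hg'⟩ := ih ε hε
    refine ⟨1 - g, sub_mem hone hg, ?_⟩
    have : 1 - g - Sᶜ.indicator 1 = -(g - S.indicator 1) := by
      rw [Set.indicator_compl]; abel
    rwa [this, eLpNorm_neg]
  | iUnion S hd hS ih =>
    intro ε hε
    have hε2 : ε / 2 ≠ 0 := (ENNReal.half_pos hε).ne'
    have htail : Tendsto (fun n => m ((⋃ i, S i) \ ⋃ i ∈ Finset.range n, S i)) atTop (𝓝 0) := by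
      have hanti : Antitone fun n => (⋃ i, S i) \ ⋃ i ∈ Finset.range n, S i := fun a b hab =>
        Set.sdiff_subset_sdiff_right (Set.biUnion_subset_biUnion_left
          fun i hi => Finset.mem_coe.2 (Finset.range_mono hab hi))
      have h := tendsto_measure_iInter_atTop (μ := m)
        (fun n => ((MeasurableSet.iUnion hS).diff
          (Finset.measurableSet_biUnion _ fun i _ => hS i)).nullMeasurableSet) hanti
        ⟨0, measure_ne_top _ _⟩
      have he : ⋂ n, ((⋃ i, S i) \ ⋃ i ∈ Finset.range n, S i) = ∅ := by
        refine Set.eq_empty_of_forall_notMem fun p hp => ?_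
        rw [Set.mem_iInter] at hp
        obtain ⟨i, hi⟩ := Set.mem_iUnion.1 (hp 0).1
        exact (hp (i + 1)).2 (Set.mem_biUnion (Finset.mem_coe.2 (Finset.self_mem_range_succ i)) hi)
      rwa [he, measure_empty] at h
    -- Half of `ε` pays for the tail of the union, the other half for approximating the first `n`
    -- sets.
    obtain ⟨n, hn⟩ := (htail.eventually_le_const (pos_iff_ne_zero.2 hε2)).exists
    have hfin : ∀ k : ℕ, ∀ δ : ℝ≥0∞, δ ≠ 0 → ∃ g ∈ productSpan X Y,
        eLpNorm (g - (⋃ i ∈ Finset.range k, S i).indicator 1) 1 m ≤ δ := by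
      intro k
      induction k with
      | zero => exact fun δ _ => ⟨0, zero_mem _, by simp⟩
      | succ k ihk =>
        intro δ hδ
        have hδ2 : δ / 2 ≠ 0 := (ENNReal.half_pos hδ).ne'
        obtain ⟨g, hg, hg'⟩ := ihk _ hδ2
        obtain ⟨f, hf, hf'⟩ := ih k _ hδ2
        refine ⟨g + f, add_mem hg hf, ?_⟩
        have hu : ⋃ i ∈ Finset.range (k + 1), S i = (⋃ i ∈ Finset.range k, S i) ∪ S k := by
          rw [Finset.range_add_one, Finset.set_biUnion_insert, Set.union_comm]
        have hdisj : Disjoint (⋃ i ∈ Finset.range k, S i) (S k) := by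
          simp only [Set.disjoint_iUnion_left]
          exact fun i hi => hd (Finset.mem_range.1 hi).ne
        have : g + f - (⋃ i ∈ Finset.range (k + 1), S i).indicator 1 =
            (g - (⋃ i ∈ Finset.range k, S i).indicator 1) + (f - (S k).indicator 1) := by
          rw [hu, Set.indicator_union_of_disjoint hdisj]
          ext p
          simp only [Pi.add_apply, Pi.sub_apply]
          ring
        rw [this]
        refine (eLpNorm_add_le (meas hg (Finset.measurableSet_biUnion _ fun i _ => hS i))
          (meas hf (hS k)) le_rfl).trans ((add_le_add hg' hf').trans_eq (ENNReal.add_halves δ))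
    obtain ⟨g, hg, hg'⟩ := hfin n _ hε2
    refine ⟨g, hg, ?_⟩
    have hsub : ⋃ i ∈ Finset.range n, S i ⊆ ⋃ i, S i := Set.iUnion₂_subset_iUnion _ _
    have : g - (⋃ i, S i).indicator 1 = (g - (⋃ i ∈ Finset.range n, S i).indicator 1) -
        ((⋃ i, S i) \ ⋃ i ∈ Finset.range n, S i).indicator 1 := by
      rw [Set.indicator_sdiff hsub]; abel
    rw [this]
    have mD : MeasurableSet ((⋃ i, S i) \ ⋃ i ∈ Finset.range n, S i) :=
      (MeasurableSet.iUnion hS).diff (Finset.measurableSet_biUnion _ fun i _ => hS i)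
    refine (eLpNorm_sub_le (meas hg (Finset.measurableSet_biUnion _ fun i _ => hS i))
      (measurable_one.indicator mD).aestronglyMeasurable le_rfl).trans
      ((add_le_add hg' ?_).trans_eq (ENNReal.add_halves ε))
    have h1 : eLpNorm (((⋃ i, S i) \ ⋃ i ∈ Finset.range n, S i).indicator (1 : X × Y → ℂ)) 1 m =
        m ((⋃ i, S i) \ ⋃ i ∈ Finset.range n, S i) := by
      have := eLpNorm_indicator_const (μ := m) (p := 1) (c := (1 : ℂ)) mD one_ne_zero
        ENNReal.one_ne_top
      rwa [enorm_one, ENNReal.toReal_one, div_one, ENNReal.rpow_one, one_mul] at this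
    rwa [h1]

theorem exists_productSpan_near (m : Measure (X × Y)) [IsFiniteMeasure m] {q : X × Y → ℂ}
    (hq : Integrable q m) {ε : ℝ≥0∞} (hε : ε ≠ 0) :
    ∃ g ∈ productSpan X Y, ∫⁻ p, ‖q p - g p‖ₑ ∂m ≤ ε := by
  obtain ⟨g, hg, hg'⟩ := MemLp.induction_dense (μ := m) (p := 1) ENNReal.one_ne_top
    (fun g => g ∈ productSpan X Y) (fun c S hS _ ε hε => by
      rcases eq_or_ne c 0 with rfl | hc
      · exact ⟨0, by simp, zero_mem _⟩
      have hc' : ‖c‖ₑ ≠ 0 := by simpa using hc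
      obtain ⟨g, hg, hg'⟩ := exists_productSpan_indicator_near m hS (ε / ‖c‖ₑ)
        (ENNReal.div_ne_zero.2 ⟨hε, enorm_ne_top⟩)
      refine ⟨c • g, ?_, Submodule.smul_mem _ c hg⟩
      have : c • g - S.indicator (fun _ => c) = c • (g - S.indicator 1) := by
        ext p
        by_cases h : p ∈ S <;> simp [h, mul_sub]
      rw [this, eLpNorm_const_smul]
      exact (mul_le_mul_right hg' _).trans ENNReal.mul_div_le)
    (fun f g hf hg => add_mem hf hg)
    (fun f hf => (measurable_bounded_of_mem_productSpan hf).1.aestronglyMeasurable)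
    (memLp_one_iff_integrable.2 hq) hε
  refine ⟨g, hg', ?_⟩
  rwa [eLpNorm_one_eq_lintegral_enorm] at hg

end Density

/-! ### Kernels near a compact operator are almost dominated by a finite measure -/

section Domination

variable {E : Type*} [MeasurableSpace E] {V : E → Set.Ioi (0 : ℝ)}

/-- Compactness is transferred from functions to points. A finite `ε`-net `t` of the image of the
unit ball maps `x` to the vector of values `g x / V x`, which stays in a bounded subset of the
finite-dimensional space `t → ℂ`. Finitely many points of `E` thus represent all values up to `ε`;
two more `ε` come from replacing `K f` by a net element at `x` and at `z`. -/
theorem IsCompactOperator.exists_finset_dist_le {K : WeightedLInf V →L[ℂ] WeightedLInf V}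
    (hK : IsCompactOperator K) {ε : ℝ} (hε : 0 < ε) :
    ∃ F : Finset E, ∀ x, ∃ z ∈ F, ∀ f : WeightedLInf V, ‖f‖ ≤ 1 →
      dist (K f x / ((V x : ℝ) : ℂ)) (K f z / ((V z : ℝ) : ℂ)) ≤ 3 * ε := by
  classical
  have hK1 : IsCompactOperator (K : WeightedLInf V →ₗ[ℂ] WeightedLInf V) := hK
  have htb := ((hK1.isCompact_closure_image_closedBall 1).totallyBounded).subset subset_closure
  obtain ⟨t, ht, htK⟩ := Metric.totallyBounded_iff.1 htb ε hε
  have := ht.fintype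
  let Φ : E → t → ℂ := fun x g => (g : WeightedLInf V) x / ((V x : ℝ) : ℂ)
  have hb : Bornology.IsBounded (Φ '' Set.univ) := by
    refine Bornology.IsBounded.subset (Metric.isBounded_closedBall (x := (0 : t → ℂ))
      (r := ∑ g : t, ‖(g : WeightedLInf V)‖)) ?_
    rintro _ ⟨x, -, rfl⟩
    rw [mem_closedBall_zero_iff, pi_norm_le_iff_of_nonneg
      (Finset.sum_nonneg fun _ _ => norm_nonneg _)]
    exact fun g => ((g : WeightedLInf V).norm_div_le x).trans
      (Finset.single_le_sum (f := fun g : t => ‖(g : WeightedLInf V)‖)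
        (fun _ _ => norm_nonneg _) (Finset.mem_univ g))
  obtain ⟨s, hs, hsf, hsc⟩ := 
    (hb.isCompact_closure.totallyBounded.subset subset_closure).exists_subset
      (Metric.dist_mem_uniformity hε)
  obtain ⟨s, rfl⟩ := hsf.exists_finset_coe
  obtain ⟨F, -, rfl⟩ := Finset.subset_set_image_iff.1 hs
  refine ⟨F, fun x => ?_⟩
  obtain ⟨w, hw, hxw⟩ := Set.mem_iUnion₂.1 (hsc ⟨x, trivial, rfl⟩)
  obtain ⟨z, hz, rfl⟩ := Finset.mem_image.1 hw
  refine ⟨z, hz, fun f hf => ?_⟩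
  obtain ⟨g, hg, hfg⟩ := Set.mem_iUnion₂.1 (htK ⟨f, by simpa using hf, rfl⟩)
  have hdist : ∀ y, dist (K f y / ((V y : ℝ) : ℂ)) (g y / ((V y : ℝ) : ℂ)) ≤ ε := fun y => by
    have h1 := (K f - g).norm_div_le y
    have h2 : (K f - g) y = K f y - g y := rfl
    rw [h2, sub_div] at h1
    rw [dist_eq_norm]
    exact h1.trans ((dist_eq_norm (K f) g).symm.trans_le (Metric.mem_ball.1 hfg).le)
  have hΦ : dist (g x / ((V x : ℝ) : ℂ)) (g z / ((V z : ℝ) : ℂ)) ≤ ε :=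
    (dist_le_pi_dist (Φ x) (Φ z) ⟨g, hg⟩).trans (le_of_lt hxw)
  calc _ ≤ _ := dist_triangle4 _ _ _ _
    _ ≤ ε + ε + ε := add_le_add (add_le_add (hdist x) hΦ) (by rw [dist_comm]; exact hdist z)
    _ = 3 * ε := by ring

theorem exists_measure_dominating (hV : Measurable V) (κ : Kernel E E) [IsFiniteKernel κ]
    {K : WeightedLInf V →L[ℂ] WeightedLInf V} (hK : IsCompactOperator K) {c : ℝ}
    (h : ‖kernelOp hV κ - K‖ < c) :
    ∃ (ν : Measure E) (_ : IsFiniteMeasure ν), ∀ x (A : Set E), MeasurableSet A →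
      κ x A ≤ ν A + ENNReal.ofReal (3 * c) := by
  have hc : 0 < c := (norm_nonneg _).trans_lt h
  obtain ⟨F, hF⟩ := hK.exists_finset_dist_le (show 0 < c / 3 by positivity)
  -- The representative `z` depends on `x`, so the sum over all of `F` is used. The error `3 * c` is
  -- `c` for moving `K f` from `x` to `z`, plus `c` at each end for replacing `kernelOp hV κ` by
  -- `K`.
  refine ⟨∑ z ∈ F, κ z, inferInstance, fun x A hA => ?_⟩
  obtain ⟨z, hz, hxz⟩ := hF x
  set f := WeightedLInf.weightIndicator hV hA with hf
  have hf1 : ‖f‖ ≤ 1 := WeightedLInf.norm_weightIndicator_le hV hA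
  have hd : ∀ y, dist (kernelOp hV κ f y / ((V y : ℝ) : ℂ)) (K f y / ((V y : ℝ) : ℂ)) ≤ c :=
    fun y => by
      have h1 := ((kernelOp hV κ - K) f).norm_div_le y
      have h2 : ((kernelOp hV κ - K) f) y = kernelOp hV κ f y - K f y := rfl
      rw [h2, sub_div] at h1
      rw [dist_eq_norm]
      refine h1.trans (((kernelOp hV κ - K).le_opNorm f).trans ?_)
      exact (mul_le_of_le_one_right (norm_nonneg _) hf1).trans h.le
  have h4 : dist (kernelOp hV κ f x / ((V x : ℝ) : ℂ)) (kernelOp hV κ f z / ((V z : ℝ) : ℂ)) ≤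
      3 * c := by
    have h1 := dist_triangle4 (kernelOp hV κ f x / ((V x : ℝ) : ℂ)) (K f x / ((V x : ℝ) : ℂ))
      (K f z / ((V z : ℝ) : ℂ)) (kernelOp hV κ f z / ((V z : ℝ) : ℂ))
    have h2 := hd z
    rw [dist_comm] at h2
    linarith [hd x, hxz f hf1]
  rw [hf, kernelOp_weightIndicator_div, kernelOp_weightIndicator_div, dist_eq_norm,
    ← Complex.ofReal_sub, Complex.norm_real] at h4
  have h5 : (κ x A).toReal ≤ (κ z A).toReal + 3 * c := by
    linarith [(le_abs_self _).trans h4]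
  calc κ x A = ENNReal.ofReal (κ x A).toReal := (ENNReal.ofReal_toReal (measure_ne_top _ _)).symm
    _ ≤ ENNReal.ofReal ((κ z A).toReal + 3 * c) := ENNReal.ofReal_le_ofReal h5
    _ = κ z A + ENNReal.ofReal (3 * c) := by
        rw [ENNReal.ofReal_add ENNReal.toReal_nonneg (by positivity),
          ENNReal.ofReal_toReal (measure_ne_top _ _)]
    _ ≤ _ := by
        refine add_le_add_left ?_ _
        rw [Measure.finsetSum_apply]
        exact Finset.single_le_sum (f := fun z => κ z A) (fun _ _ => zero_le) hz

/-- A finite kernel that is almost dominated by a finite measure is the sum of a kernel with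
bounded density and of a small kernel. -/
theorem exists_eq_withDensity_add [MeasurableSpace.CountablyGenerated E] (κ : Kernel E E)
    [IsFiniteKernel κ] (ν : Measure E) [IsFiniteMeasure ν] {c δ : ℝ≥0∞} (hδ : δ ≠ 0)
    (h : ∀ x (A : Set E), MeasurableSet A → κ x A ≤ ν A + c) :
    ∃ (q : E → E → ℝ≥0∞) (M : ℝ≥0) (S : Kernel E E), Measurable (Function.uncurry q) ∧
      (∀ x y, q x y ≤ M) ∧ κ = (Kernel.const E ν).withDensity q + S ∧
      ∀ x, S x Set.univ ≤ δ + c := by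
  set η := Kernel.const E ν
  set p := Kernel.rnDeriv κ η
  have mp : Measurable (Function.uncurry p) := Kernel.measurable_rnDeriv κ η
  -- The level is chosen so that Markov's inequality gives `ν {p x > M} ≤ δ`; the added `1` only
  -- makes `M` nonzero, so that it can be cancelled.
  set M : ℝ≥0 := (κ.bound / δ).toNNReal + 1
  have hM0 : (M : ℝ≥0∞) ≠ 0 := by simp [M]
  have hM : κ.bound / δ ≤ M := by
    rw [← ENNReal.coe_toNNReal (ENNReal.div_ne_top κ.bound_ne_top hδ)]
    exact ENNReal.coe_le_coe.2 (le_add_of_nonneg_right zero_le_one)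
  set q : E → E → ℝ≥0∞ := fun x y => min (p x y) M
  have mq : Measurable (Function.uncurry q) := mp.min measurable_const
  set r : E → E → ℝ≥0∞ := fun x y => p x y - M
  have mr : Measurable (Function.uncurry r) := mp.sub measurable_const
  have hqr : p = q + r := by
    ext x y
    change p x y = min (p x y) M + (p x y - M)
    rcases le_total (p x y) M with h | h
    · rw [min_eq_left h, tsub_eq_zero_of_le h, add_zero]
    · rw [min_eq_right h, add_tsub_cancel_of_le h]
  -- The remainder at `x` lives on the singular set `N`, which is `ν`-null, and on the set `G` where
  -- the density exceeds `M`. Applying `h` to `N ∪ G` therefore bounds its whole mass.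
  set S := η.withDensity r + κ.singularPart η
  have hκ : κ = η.withDensity q + S := by
    have h1 := Kernel.rnDeriv_add_singularPart κ η
    change η.withDensity p + _ = κ at h1
    rw [hqr, Kernel.withDensity_add_right mq mr, add_assoc] at h1
    exact h1.symm
  refine ⟨q, M, S, mq, fun x y => min_le_right _ _, hκ, fun x => ?_⟩
  have mpx : Measurable (p x) := mp.of_uncurry_left
  set G := {y | (M : ℝ≥0∞) < p x y}
  have mG : MeasurableSet G := measurableSet_lt measurable_const mpx
  set N := Kernel.mutuallySingularSetSlice κ η x
  have mN : MeasurableSet N := Kernel.measurableSet_mutuallySingularSetSlice κ η x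
  have hSc : S x (N ∪ G)ᶜ = 0 := by
    change (η.withDensity r x + κ.singularPart η x) _ = 0
    rw [Measure.add_apply, Set.compl_union]
    have h1 : κ.singularPart η x (Nᶜ ∩ Gᶜ) = 0 := measure_mono_null Set.inter_subset_left
      (Kernel.singularPart_compl_mutuallySingularSetSlice κ η x)
    have h2 : η.withDensity r x (Nᶜ ∩ Gᶜ) = 0 := by
      refine measure_mono_null Set.inter_subset_right ?_
      rw [Kernel.withDensity_apply' _ mr, setLIntegral_congr_fun (g := 0) mG.compl
        (fun y hy => tsub_eq_zero_of_le (not_lt.1 hy))]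
      simp
    rw [h1, h2, add_zero]
  have hνN : ν N = 0 := Kernel.measure_mutuallySingularSetSlice κ η x
  have hνG : ν G ≤ δ := by
    have h1 : M * ν G ≤ κ.bound := by
      calc M * ν G ≤ M * ν {y | (M : ℝ≥0∞) ≤ p x y} := by
            gcongr; exact fun y hy => le_of_lt (Set.mem_ofPred.1 hy)
        _ ≤ ∫⁻ y, p x y ∂ν := mul_meas_ge_le_lintegral mpx _
        _ = η.withDensity p x Set.univ := by
            rw [Kernel.withDensity_apply' _ mp, setLIntegral_univ, Kernel.const_apply]
        _ ≤ κ x Set.univ := by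
            conv_rhs => rw [← Kernel.rnDeriv_add_singularPart κ η]
            exact le_add_right le_rfl
        _ ≤ κ.bound := κ.measure_le_bound x _
    rcases eq_or_ne δ ∞ with rfl | hδt
    · exact le_top
    have h2 : κ.bound ≤ M * δ := (ENNReal.div_le_iff hδ hδt).1 hM
    exact (ENNReal.mul_le_mul_iff_right hM0 ENNReal.coe_ne_top).1 (h1.trans h2)
  calc S x Set.univ ≤ S x (N ∪ G) + S x (N ∪ G)ᶜ := by
        rw [← Set.union_compl_self (N ∪ G)]; exact measure_union_le _ _
    _ = S x (N ∪ G) := by rw [hSc, add_zero]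
    _ ≤ κ x (N ∪ G) := by
        conv_rhs => rw [hκ]
        exact le_add_left le_rfl
    _ ≤ ν (N ∪ G) + c := h x _ (mN.union mG)
    _ ≤ δ + c := by
        gcongr
        exact (measure_union_le _ _).trans (by rw [hνN, zero_add]; exact hνG)

end Domination

/-! ### Compactness of products of kernels with densities -/

section Compactness

variable {E : Type*} [MeasurableSpace E] {V : E → Set.Ioi (0 : ℝ)}

theorem integrable_mul_div (hV : Measurable V) (ν : Measure E) [IsFiniteMeasure ν] {b : E → ℂ}
    (hb : Measurable b) {D : ℝ} (hD : ∀ y, ‖b y‖ ≤ D) (f : WeightedLInf V) :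
    Integrable (fun y => b y * (f y / ((V y : ℝ) : ℂ))) ν :=
  (f.integrable_div hV ν).bdd_mul hb.aestronglyMeasurable (ae_of_all _ hD)

theorem exists_functional_eq_integral (hV : Measurable V) (ν : Measure E) [IsFiniteMeasure ν]
    {b : E → ℂ} (hb : Measurable b) (hD : ∃ D, ∀ y, ‖b y‖ ≤ D) :
    ∃ φ : WeightedLInf V →L[ℂ] ℂ, ∀ f, φ f = ∫ y, b y * (f y / ((V y : ℝ) : ℂ)) ∂ν := by
  obtain ⟨D, hD⟩ := hD
  refine ⟨LinearMap.mkContinuous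
    { toFun := fun f => ∫ y, b y * (f y / ((V y : ℝ) : ℂ)) ∂ν
      map_add' := fun f g => ?_
      map_smul' := fun c f => ?_ } (D * ν.real Set.univ) fun f => ?_, fun f => rfl⟩
  · simp only [WeightedLInf.add_apply, add_div, mul_add]
    exact integral_add (integrable_mul_div hV ν hb hD f) (integrable_mul_div hV ν hb hD g)
  · simp only [WeightedLInf.smul_apply, RingHom.id_apply, smul_eq_mul]
    rw [← integral_const_mul]
    exact integral_congr_ae (ae_of_all _ fun y => by simp only; ring)
  · refine (norm_integral_le_of_norm_le_const (C := D * ‖f‖) (ae_of_all _ fun y => ?_)).trans_eq ?_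
    · rw [norm_mul]
      exact mul_le_mul (hD y) (f.norm_div_le y) (norm_nonneg _) ((norm_nonneg _).trans (hD y))
    · ring

/-- A product `a x * b y` gives a rank-one operator, so elements of the span give finite-rank ones.
-/
theorem exists_compact_of_mem_productSpan (hV : Measurable V) (ν : Measure E) [IsFiniteMeasure ν]
    {g : E × E → ℂ} (hg : g ∈ productSpan E E) :
    ∃ F : WeightedLInf V →L[ℂ] WeightedLInf V, IsCompactOperator F ∧ ∀ f x,
      F f x / ((V x : ℝ) : ℂ) = ∫ y, g (x, y) * (f y / ((V y : ℝ) : ℂ)) ∂ν := by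
  have hint : ∀ {g : E × E → ℂ}, g ∈ productSpan E E → ∀ (f : WeightedLInf V) (x : E),
      Integrable (fun y => g (x, y) * (f y / ((V y : ℝ) : ℂ))) ν := fun hg f x => by
    obtain ⟨mg, C, hC⟩ := measurable_bounded_of_mem_productSpan hg
    exact integrable_mul_div hV ν (mg.comp measurable_prodMk_left) (fun y => hC (x, y)) f
  induction hg using Submodule.span_induction with
  | mem g hg =>
    obtain ⟨a, b, ha, hb, hC, hD, rfl⟩ := hg
    obtain ⟨φ, hφ⟩ := exists_functional_eq_integral hV ν hb hD
    have hc : IsCompactOperator (ContinuousLinearMap.toSpanSingleton ℂ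
      (WeightedLInf.ofBounded hV a ha hC)) := isCompactOperator_of_locallyCompactSpace_rng _
    refine ⟨(ContinuousLinearMap.toSpanSingleton ℂ
      (WeightedLInf.ofBounded hV a ha hC)).comp φ, hc.comp_clm φ, fun f x => ?_⟩
    have h1 : ((ContinuousLinearMap.toSpanSingleton ℂ
      (WeightedLInf.ofBounded hV a ha hC)).comp φ) f x = φ f * (V x * a x) := rfl
    have h2 : ((V x : ℝ) : ℂ) ≠ 0 := Complex.ofReal_ne_zero.2 (WeightedLInf.weight_pos x).ne'
    rw [h1, hφ]
    simp only [mul_assoc]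
    rw [integral_const_mul]
    field_simp
  | zero => exact ⟨0, isCompactOperator_zero, fun f x => by
      simp [WeightedLInf.zero_apply]⟩
  | add g h hg hh ihg ihh =>
    obtain ⟨F, hF, hF'⟩ := ihg
    obtain ⟨G, hG, hG'⟩ := ihh
    refine ⟨F + G, hF.add hG, fun f x => ?_⟩
    rw [add_apply, WeightedLInf.add_apply, add_div, hF', hG',
      ← integral_add (hint hg f x) (hint hh f x)]
    simp only [Pi.add_apply, add_mul]
  | smul c g hg ih =>
    obtain ⟨F, hF, hF'⟩ := ih
    refine ⟨c • F, hF.smul c, fun f x => ?_⟩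
    have h1 : (c • F) f x = c * F f x := rfl
    rw [h1, mul_div_assoc, hF', ← integral_const_mul]
    simp only [Pi.smul_apply, smul_eq_mul, mul_assoc]

/-- Approximating `q` in `L¹` by sums of products does not approximate `kernelOp hV η` in norm,
since that would need uniformity in `x`. Composing first with a kernel dominated by a single measure
`μ` averages over `x`: the error is then at most the `L¹(μ × ν)` distance, whatever the starting
point. -/
theorem isCompactOperator_kernelOp_mul (hV : Measurable V) (κ η : Kernel E E) [IsFiniteKernel κ]
    [IsFiniteKernel η] (μ ν : Measure E) [IsFiniteMeasure μ] [IsFiniteMeasure ν]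
    (hκ : ∀ x, κ x ≤ μ) {q : E → E → ℝ≥0∞} (mq : Measurable (Function.uncurry q)) {M : ℝ≥0}
    (hq : ∀ x y, q x y ≤ M) (hη : η = (Kernel.const E ν).withDensity q) :
    IsCompactOperator (kernelOp hV κ * kernelOp hV η : WeightedLInf V →L[ℂ] WeightedLInf V) := by
  let Q : E × E → ℂ := fun p => ((q p.1 p.2).toReal : ℂ)
  have mQ : Measurable Q := Complex.measurable_ofReal.comp mq.ennreal_toReal
  have hQ : ∀ p, ‖Q p‖ ≤ M := fun p => by
    simp only [Q, Complex.norm_real, Real.norm_of_nonneg ENNReal.toReal_nonneg]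
    exact ENNReal.toReal_mono ENNReal.coe_ne_top (hq _ _)
  have hop : ∀ f x, kernelOp hV η f x / ((V x : ℝ) : ℂ) =
      ∫ y, Q (x, y) * (f y / ((V y : ℝ) : ℂ)) ∂ν := fun f x => by
    rw [kernelOp_div, hη, Kernel.withDensity_apply _ mq, Kernel.const_apply,
      integral_withDensity_eq_integral_toReal_smul mq.of_uncurry_left
        (ae_of_all _ fun y => (hq x y).trans_lt ENNReal.coe_lt_top)]
    simp only [Complex.real_smul, Q]
  refine isClosed_setOfPred_isCompactOperator.closure_subset_iff.2 subset_rfl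
    (Metric.mem_closure_iff.2 fun ε hε => ?_)
  obtain ⟨g, hg, hgQ⟩ := exists_productSpan_near (μ.prod ν)
    (Integrable.of_bound mQ.aestronglyMeasurable M (ae_of_all _ hQ))
    (ENNReal.ofReal_pos.2 (half_pos hε)).ne'
  obtain ⟨mg, C, hC⟩ := measurable_bounded_of_mem_productSpan hg
  obtain ⟨F, hF, hF'⟩ := exists_compact_of_mem_productSpan hV ν hg
  refine ⟨kernelOp hV κ * F, hF.clm_comp (kernelOp hV κ), ?_⟩
  rw [dist_eq_norm, ← mul_sub]
  refine lt_of_le_of_lt (ContinuousLinearMap.opNorm_le_bound _ (half_pos hε).le fun f => ?_)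
    (half_lt_self hε)
  refine WeightedLInf.norm_le_of_enorm_div _
    (mul_nonneg (half_pos hε).le (norm_nonneg f)) fun x => ?_
  have hdiff : ∀ y, ‖(kernelOp hV η - F) f y / ((V y : ℝ) : ℂ)‖ₑ ≤
      (∫⁻ z, ‖Q (y, z) - g (y, z)‖ₑ ∂ν) * ENNReal.ofReal ‖f‖ := fun y => by
    have h1 : (kernelOp hV η - F) f y = kernelOp hV η f y - F f y := rfl
    rw [h1, sub_div, hop, hF', ← integral_sub
      (integrable_mul_div hV ν (b := fun z => Q (y, z)) (mQ.comp measurable_prodMk_left)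
        (fun z => hQ (y, z)) f)
      (integrable_mul_div hV ν (b := fun z => g (y, z)) (mg.comp measurable_prodMk_left)
        (fun z => hC (y, z)) f),
      ← lintegral_mul_const' _ _ ENNReal.ofReal_ne_top]
    refine (enorm_integral_le_lintegral_enorm _).trans (lintegral_mono fun z => ?_)
    rw [← sub_mul, enorm_mul]
    exact mul_le_mul_right (f.enorm_div_le z) _
  calc _ ≤ ∫⁻ y, ‖(kernelOp hV η - F) f y / ((V y : ℝ) : ℂ)‖ₑ ∂(κ x) :=
        enorm_kernelOp_div_le hV κ ((kernelOp hV η - F) f) x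
    _ ≤ ∫⁻ y, (∫⁻ z, ‖Q (y, z) - g (y, z)‖ₑ ∂ν) * ENNReal.ofReal ‖f‖ ∂μ :=
        lintegral_mono' (hκ x) hdiff
    _ = (∫⁻ p, ‖Q p - g p‖ₑ ∂(μ.prod ν)) * ENNReal.ofReal ‖f‖ := by
        rw [lintegral_mul_const' _ _ ENNReal.ofReal_ne_top,
          lintegral_prod (fun p => ‖Q p - g p‖ₑ) (mQ.sub mg).enorm.aemeasurable]
    _ ≤ ENNReal.ofReal (ε / 2) * ENNReal.ofReal ‖f‖ := mul_le_mul_left hgQ _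
    _ = _ := (ENNReal.ofReal_mul (half_pos hε).le).symm

end Compactness

/-! ### From domination by a measure to the comparison of essential spectral radii -/

theorem ProbabilityTheory.Kernel.comp_apply_le_bind {E : Type*} [MeasurableSpace E] {κ η : Kernel E E}
    {μ : Measure E} (h : ∀ x, κ x ≤ μ) (x : E) : (η ∘ₖ κ) x ≤ μ.bind η := by
  refine Measure.le_iff.2 fun A hA => ?_
  rw [Kernel.comp_apply' _ _ _ hA, Measure.bind_apply hA η.aemeasurable]
  exact lintegral_mono' (h x) le_rfl

theorem ProbabilityTheory.Kernel.withDensity_const_apply_le {E : Type*} [MeasurableSpace E] {ν : Measure E}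
    [IsFiniteMeasure ν] {q : E → E → ℝ≥0∞} (mq : Measurable (Function.uncurry q)) {M : ℝ≥0}
    (hq : ∀ x y, q x y ≤ M) (x : E) : (Kernel.const E ν).withDensity q x ≤ M • ν := by
  refine Measure.le_iff.2 fun A hA => ?_
  rw [Kernel.withDensity_apply' _ mq, Kernel.const_apply]
  calc ∫⁻ y in A, q x y ∂ν ≤ ∫⁻ _ in A, M ∂ν := lintegral_mono (hq x)
    _ = (M • ν) A := by
        rw [MeasureTheory.setLIntegral_const]; rfl

/-- If the `n`-th power of a finite kernel is almost dominated by a finite measure, then its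
essential spectral radius is small. -/
theorem essSpectralRadius_kernelOp_pow_le {E : Type*} [MeasurableSpace E]
    [MeasurableSpace.CountablyGenerated E] {V : E → Set.Ioi (0 : ℝ)} (hV : Measurable V)
    (κ : Kernel E E) [IsFiniteKernel κ] {n : ℕ} (hn : n ≠ 0) (ν : Measure E) [IsFiniteMeasure ν]
    {c : ℝ} (hc : 0 < c)
    (h : ∀ x (A : Set E), MeasurableSet A → (κ ^ n) x A ≤ ν A + ENNReal.ofReal c) :
    essSpectralRadius (kernelOp hV κ) ^ n ≤ 2 * c := by
  -- Taking `δ = c` makes the mass of `S` at most `2 * c`.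
  obtain ⟨q, M, S, mq, hq, hκ, hS⟩ := exists_eq_withDensity_add (κ ^ n) ν
    (ENNReal.ofReal_pos.2 hc).ne' h
  set A := (Kernel.const E ν).withDensity q with hA
  have : IsFiniteKernel A := Kernel.isFiniteKernel_withDensity_of_bounded _ ENNReal.coe_ne_top hq
  have hS' : ∀ x, S x Set.univ ≤ ENNReal.ofReal (2 * c) := fun x => by
    rw [two_mul, ENNReal.ofReal_add hc.le hc.le]
    exact hS x
  have : IsFiniteKernel S := ⟨⟨_, ENNReal.ofReal_lt_top, hS'⟩⟩
  refine essSpectralRadius_pow_le_of_compact _ hn (kernelOp hV A) (kernelOp hV S) ?_ (fun j => ?_)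
    (by positivity) (norm_kernelOp_le hV S (by positivity) hS')
  · rw [← kernelOp_pow, ← kernelOp_add]
    exact kernelOp_congr hV hκ
  · rw [← kernelOp_pow, ← kernelOp_comp]
    -- The left factor `A * S ^ j` comes from the kernel `S ^ j ∘ₖ A`. Since `A x ≤ M • ν` for every
    -- `x`, this kernel is dominated by the image of `M • ν` under `S ^ j`.
    exact isCompactOperator_kernelOp_mul hV _ _ ((M • ν).bind (S ^ j : Kernel E E)) ν
      (Kernel.comp_apply_le_bind (Kernel.withDensity_const_apply_le mq hq)) mq hq hA

theorem mainTheorem2 {E : Type*} [MeasurableSpace E] [MeasurableSpace.CountablyGenerated E]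
    (V : E → Set.Ioi (0 : ℝ)) (hV : Measurable V) (P Q : Kernel E E)
    (hP : IsKernelTo V P) (hQ : IsKernelTo V Q)
    (hPQ : ∀ f : WeightedLInf V, 0 ≤ f → 0 ≤ hP.op f ∧ hP.op f ≤ hQ.op f) :
    essSpectralRadius hP.op ≤ essSpectralRadius hQ.op := by
  obtain ⟨κ, _, hκ⟩ := hP.exists_finite_kernel hV
  obtain ⟨η, _, hη⟩ := hQ.exists_finite_kernel hV
  rw [hκ, hη] at hPQ ⊢
  have hle : κ ≤ η := Kernel.le_of_kernelOp_le hV κ η fun f hf => (hPQ f hf).2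
  -- The constant is `2 * 3`: a factor `3` from `exists_measure_dominating` and a factor `2` from
  -- `essSpectralRadius_kernelOp_pow_le`.
  refine essSpectralRadius_le_of_pow_le _ _ (C := 6) (by norm_num) fun n hn r hr K hK h => ?_
  rw [← kernelOp_pow] at h
  obtain ⟨ν, _, hν⟩ := exists_measure_dominating hV (η ^ n) hK h
  refine (essSpectralRadius_kernelOp_pow_le hV κ hn ν (c := 3 * r) (by positivity)
    fun x A hA => ?_).trans_eq (by ring)
  exact (Kernel.pow_le_pow hle n x A).trans (hν x A hA)
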